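/- Let $\Omega\subseteq\mathbb C^n$ be a bounded open set and let $V\subseteq\Omega$. For a set $S$ and a function $f$ write $\|f\|_S=\sup_{z\in S}|f(z)|$ (with $\|f\|_\emptyset=0$), and let $H^\infty(\Omega)$ be the set of bounded holomorphic functions on $\Omega$. Suppose that (i) $V$ is relatively polynomially convex in $\Omega$, that is, $\hat V\cap\Omega=V$, where $\hat V=\{z\in\mathbb C^n: |p(z)|\le\|p\|_V\text{ for every polynomial }p\in\mathbb C[z_1,\dots,z_n]\}$ is the polynomial hull of $V$ (this holds in particular if $\overline V\cap\Omega=V$ and $\overline V$ is polynomially convex); (ii) $V$ has the extension property, that is, for every polynomial $p\in\mathbb C[z_1,\dots,z_n]$ there is $F\in H^\infty(\Omega)$ with $F|_V=p|_V$ and $\|F\|_\Omega=\|p\|_V$. Then $V$ is a holomorphic subvariety of $\Omega$: every point $a\in\Omega$ has an open neighbourhood $W\subseteq\Omega$ in which $V$ is the common zero set of finitely many holomorphic functions on $W$. Moreover these functions can be chosen in $H^\infty(\Omega)$: for every $a\in\Omega$ there are an open set $W$ with $a\in W\subseteq\Omega$ and finitely many $f_1,\dots,f_k\in H^\infty(\Omega)$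 with $$V\cap W=\{z\in W: f_1(z)=\dots=f_k(z)=0\}.$$ -/

import Mathlib

open scoped ENNReal

/- The space `ℂⁿ` is `Fin n → ℂ`. Only its topology, its bounded sets and its analytic structure are
used below, and these are the same for the Euclidean norm. -/

/-- The sup-norm `‖f‖_S = sup_{z ∈ S} |f z|`, as an element of `[0, ∞]` (it is `0` on the empty
set). -/
noncomputable def supNormOn {n : ℕ} (S : Set (Fin n → ℂ)) (f : (Fin n → ℂ) → ℂ) : ℝ≥0∞ :=
  ⨆ z ∈ S, ‖f z‖ₑ

/-- The polynomial hull of `V`: all `z` with `|p z| ≤ ‖p‖_V` for every polynomial `p`. -/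
def polynomialHull {n : ℕ} (V : Set (Fin n → ℂ)) : Set (Fin n → ℂ) :=
  {z | ∀ p : MvPolynomial (Fin n) ℂ,
    ‖MvPolynomial.eval z p‖ₑ ≤ supNormOn V (fun w => MvPolynomial.eval w p)}

/-- `V` is relatively polynomially convex in `Ω`: the part of the polynomial hull of `V` that lies
in `Ω` is `V` itself. -/
def IsRelPolynomiallyConvex {n : ℕ} (Ω V : Set (Fin n → ℂ)) : Prop :=
  polynomialHull V ∩ Ω = V

/-- Another common definition of relative polynomial convexity asks that `V` be relatively closed
in `Ω` and that its closure be polynomially convex. It implies the one used here. -/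
theorem isRelPolynomiallyConvex_of_closure {n : ℕ} {Ω V : Set (Fin n → ℂ)}
    (hcl : closure V ∩ Ω = V) (hpc : polynomialHull (closure V) = closure V) :
    IsRelPolynomiallyConvex Ω V := by
  apply Set.Subset.antisymm
  · rintro z ⟨hz, hzΩ⟩
    rw [← hcl]
    refine ⟨?_, hzΩ⟩
    rw [← hpc]
    exact fun p => (hz p).trans (biSup_mono fun _ hw => subset_closure hw)
  · intro z hz
    refine ⟨fun p => ?_, (hcl.symm ▸ hz : z ∈ closure V ∩ Ω).2⟩
    exact le_iSup₂ (f := fun w (_ : w ∈ V) => ‖MvPolynomial.eval w p‖ₑ) z hz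

/-- `H^∞(Ω)`: `f` is holomorphic (complex analytic) at every point of the open set `Ω`, and bounded
on `Ω`. -/
def IsBoundedHolomorphicOn {n : ℕ} (Ω : Set (Fin n → ℂ)) (f : (Fin n → ℂ) → ℂ) : Prop :=
  AnalyticOnNhd ℂ f Ω ∧ supNormOn Ω f < ∞

/-- `V` has the extension property in `Ω`: the restriction to `V` of every polynomial has an
extension in `H^∞(Ω)` with the same sup-norm. -/
def HasExtensionProperty {n : ℕ} (Ω V : Set (Fin n → ℂ)) : Prop :=
  ∀ p : MvPolynomial (Fin n) ℂ, ∃ F : (Fin n → ℂ) → ℂ,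
    IsBoundedHolomorphicOn Ω F ∧
    (∀ z ∈ V, F z = MvPolynomial.eval z p) ∧
    supNormOn Ω F = supNormOn V (fun z => MvPolynomial.eval z p)

/-- `V` is a holomorphic subvariety of the open set `Ω`: `V ⊆ Ω`, and every point of `Ω` (not only
of `V`) has an open neighbourhood `W ⊆ Ω` in which `V` is the common zero set of finitely many
functions that are holomorphic on `W`. -/
def IsHolomorphicSubvariety {n : ℕ} (Ω V : Set (Fin n → ℂ)) : Prop :=
  V ⊆ Ω ∧ ∀ a ∈ Ω, ∃ W : Set (Fin n → ℂ), IsOpen W ∧ a ∈ W ∧ W ⊆ Ω ∧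
    ∃ (k : ℕ) (f : Fin k → (Fin n → ℂ) → ℂ),
      (∀ i, AnalyticOnNhd ℂ (f i) W) ∧ V ∩ W = {z | z ∈ W ∧ ∀ i, f i z = 0}

/-! Let `I` be the set of bounded holomorphic functions on `Ω` that vanish on `V`. A point `z` of
`Ω` off `V` admits a polynomial `p` with `|p z| > ‖p‖_V`. If `F` extends `p|_V` with the same norm,
then `F - p` lies in `I` and is nonzero at `z`. Hence `V` is the common zero set of `I`, and it
remains to show that finitely many members of `I` suffice near each point
(`exists_finite_local_zeros`).

This Noetherian statement is proved by division with standard bases, in weighted `ℓ¹` spaces of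
power series. Multi-indices are ordered by `primeCode`, and the polydisc radii are powers of the
same primes, so a leading monomial dominates its tail once the polydisc is small. Dickson's lemma
leaves finitely many minimal leading exponents, hence one polydisc that serves all of `I`. There a
Neumann series reduces any `f ∈ I` to a remainder with no exponent above a minimal one. The
remainder equals `f` on the common zeros of the finite subfamily; were it nonzero, its own leading
exponent would contradict minimality (`exists_finite_subfamily_zeros`). -/

/-- The monomial `z ^ α = ∏ i, z i ^ α i`. -/
noncomputable def monom {n : ℕ} (z : Fin n → ℂ) (α : Fin n → ℕ) : ℂ := ∏ i, z i ^ α i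

/-! ### Cauchy estimates and multi-index power series -/

/-- Discrete orthogonality of characters. -/
lemma sum_rootOfUnity_pow_mul_inv_pow {N a b : ℕ} {ω : ℂ} (hω : IsPrimitiveRoot ω N)
    (ha : a < N) (hb : b < N) (r : ℂ) :
    ∑ k ∈ Finset.range N, (r * ω ^ k) ^ b * (ω⁻¹) ^ (k * a) = if b = a then N * r ^ b else 0 := by
  have hN : N ≠ 0 := by omega
  have hω0 : ω ≠ 0 := hω.ne_zero hN
  have key : ∀ k, (r * ω ^ k) ^ b * (ω⁻¹) ^ (k * a) = r ^ b * (ω ^ b * (ω⁻¹) ^ a) ^ k := by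
    intro k
    rw [mul_pow, mul_pow, ← pow_mul, ← pow_mul, ← pow_mul, mul_comm k b, mul_comm k a, mul_assoc]
  simp_rw [key, ← Finset.mul_sum]
  split_ifs with h
  · subst h
    have : ω ^ b * ω⁻¹ ^ b = 1 := by rw [← mul_pow, mul_inv_cancel₀ hω0, one_pow]
    simp_rw [this, one_pow]
    simp [mul_comm]
  · have h1 : ω ^ b * ω⁻¹ ^ a ≠ 1 := by
      intro h1
      apply h
      apply hω.pow_inj hb ha
      rw [inv_pow] at h1
      exact (mul_inv_eq_one₀ (pow_ne_zero _ hω0)).1 h1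
    have h2 : (ω ^ b * ω⁻¹ ^ a) ^ N = 1 := by
      rw [mul_pow, ← pow_mul, ← pow_mul, mul_comm b, mul_comm a, pow_mul, pow_mul, inv_pow,
        hω.pow_eq_one]
      simp
    have h3 := mul_geom_sum (ω ^ b * ω⁻¹ ^ a) N
    rw [h2, sub_self] at h3
    rw [(mul_eq_zero.1 h3).resolve_left (sub_ne_zero.2 h1), mul_zero]

/-- Cauchy's estimate for the coefficients of a polynomial that is bounded on a torus. -/
lemma norm_coeff_mul_pow_le {n : ℕ} (S : Finset (Fin n → ℕ)) (c : (Fin n → ℕ) → ℂ) {r M : ℝ}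
    (hr : 0 ≤ r) (h : ∀ z : Fin n → ℂ, (∀ i, ‖z i‖ = r) → ‖∑ α ∈ S, c α * monom z α‖ ≤ M)
    {α : Fin n → ℕ} (hα : α ∈ S) : ‖c α‖ * r ^ (∑ i, α i) ≤ M := by
  classical
  -- `N` exceeds every exponent that occurs, so averaging over `N`-th roots of unity in each
  -- coordinate isolates one coefficient without integration.
  set N : ℕ := 1 + ∑ β ∈ S, ∑ i, β i with hNdef
  have hN : N ≠ 0 := by omega
  have hlt : ∀ β ∈ S, ∀ i, β i < N := by
    intro β hβ i
    have h1 : β i ≤ ∑ i, β i := Finset.single_le_sum (fun _ _ => Nat.zero_le _) (Finset.mem_univ i)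
    have h2 : ∑ i, β i ≤ ∑ β ∈ S, ∑ i, β i :=
      Finset.single_le_sum (f := fun β : Fin n → ℕ => ∑ i, β i) (fun _ _ => Nat.zero_le _) hβ
    omega
  obtain ⟨ω, hω⟩ : ∃ ω : ℂ, IsPrimitiveRoot ω N := ⟨_, Complex.isPrimitiveRoot_exp N hN⟩
  have hω1 : ‖ω‖ = 1 := hω.norm'_eq_one hN
  have hz : ∀ j : Fin n → ℕ, ∀ i, ‖(fun i => (r : ℂ) * ω ^ j i) i‖ = r := by
    intro j i
    simp [hω1, abs_of_nonneg hr]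
  have key : ∑ j ∈ Fintype.piFinset fun _ : Fin n => Finset.range N,
      (∑ β ∈ S, c β * monom (fun i => (r : ℂ) * ω ^ j i) β) * ∏ i, ω⁻¹ ^ (j i * α i) =
      (N : ℂ) ^ n * (c α * (r : ℂ) ^ (∑ i, α i)) := by
    simp_rw [Finset.sum_mul]
    rw [Finset.sum_comm]
    have hterm : ∀ β ∈ S, ∑ j ∈ Fintype.piFinset fun _ : Fin n => Finset.range N,
        c β * monom (fun i => (r : ℂ) * ω ^ j i) β * ∏ i, ω⁻¹ ^ (j i * α i) =
        if β = α then (N : ℂ) ^ n * (c α * (r : ℂ) ^ (∑ i, α i)) else 0 := by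
      intro β hβ
      simp_rw [monom, mul_assoc, ← Finset.prod_mul_distrib, ← Finset.mul_sum]
      rw [Finset.sum_prod_piFinset (Finset.range N)
        (fun i k => ((r : ℂ) * ω ^ k) ^ β i * ω⁻¹ ^ (k * α i))]
      simp_rw [fun i => sum_rootOfUnity_pow_mul_inv_pow hω (hlt α hα i) (hlt β hβ i) (r : ℂ)]
      split_ifs with hβα
      · subst hβα
        simp [Finset.prod_mul_distrib, Finset.prod_pow_eq_pow_sum]
        ring
      · obtain ⟨i, hi⟩ := Function.ne_iff.1 hβα
        rw [Finset.prod_eq_zero (Finset.mem_univ i) (by simp [hi]), mul_zero]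
    rw [Finset.sum_congr rfl hterm]
    simp [hα]
  have hle : ‖(N : ℂ) ^ n * (c α * (r : ℂ) ^ (∑ i, α i))‖ ≤ (N : ℝ) ^ n * M := by
    rw [← key]
    refine (norm_sum_le_of_le (f := fun j : Fin n → ℕ => _) _ (fun j _ => ?_)).trans_eq
      (b := ∑ j ∈ Fintype.piFinset fun _ : Fin n => Finset.range N, M) ?_
    · rw [norm_mul, norm_prod]
      simp only [norm_pow, norm_inv, hω1, inv_one, one_pow, Finset.prod_const_one, mul_one]
      exact h _ (hz j)
    · simp
  rw [norm_mul, norm_mul, norm_pow, norm_pow, Complex.norm_natCast, Complex.norm_real,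
    Real.norm_of_nonneg hr] at hle
  exact le_of_mul_le_mul_left hle (by positivity)

/-- Taylor expansion of a bounded analytic function along complex lines through the centre of a
ball. -/
lemma taylor_on_line {E : Type*} [NormedAddCommGroup E] [NormedSpace ℂ E]
    {f : E → ℂ} {a : E} {R M : ℝ} {ε : ℝ≥0∞} {p : FormalMultilinearSeries ℂ E ℂ}
    (hf : AnalyticOnNhd ℂ f (Metric.ball a R)) (hM : ∀ x ∈ Metric.ball a R, ‖f x‖ ≤ M)
    (hp : HasFPowerSeriesOnBall f p a ε) {z : E} (hz : ‖z‖ < R) :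
    (∀ k, ‖p k (fun _ => z)‖ ≤ M) ∧ HasSum (fun k => p k (fun _ => z)) (f (a + z)) := by
  -- With `ρ > 1` the point `t = 1` is interior to the disc on which `t ↦ f (a + t • z)` is
  -- expanded.
  obtain ⟨ρ, hρ1, hρz⟩ : ∃ ρ : NNReal, 1 < ρ ∧ (ρ : ℝ) * ‖z‖ < R := by
    have hcont : ContinuousAt (fun ρ : NNReal => (ρ : ℝ) * ‖z‖) 1 := by fun_prop
    have h1 : ∀ᶠ ρ : NNReal in nhds 1, (ρ : ℝ) * ‖z‖ < R :=
      hcont.eventually (gt_mem_nhds (by simpa using hz))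
    have h2 : ∃ᶠ ρ : NNReal in nhds 1, 1 < ρ := frequently_gt_nhds 1
    obtain ⟨ρ, h⟩ := (h2.and_eventually h1).exists
    exact ⟨ρ, h⟩
  set g : ℂ → ℂ := fun t => f (a + t • z) with hg
  have hmem : ∀ t : ℂ, t ∈ Metric.closedBall (0 : ℂ) ρ → a + t • z ∈ Metric.ball a R := by
    intro t ht
    rw [mem_closedBall_zero_iff] at ht
    rw [mem_ball_iff_norm, add_sub_cancel_left, norm_smul]
    exact (mul_le_mul_of_nonneg_right ht (norm_nonneg _)).trans_lt hρz
  have hdiff : DifferentiableOn ℂ g (Metric.closedBall 0 ρ) := by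
    intro t ht
    apply DifferentiableAt.differentiableWithinAt
    exact (hf _ (hmem t ht)).differentiableAt.comp t (by fun_prop)
  have hs1 := hdiff.hasFPowerSeriesOnBall (zero_lt_one.trans hρ1)
  have hs2 : HasFPowerSeriesAt g
      (p.compContinuousLinearMap (ContinuousLinearMap.toSpanSingleton ℂ z)) 0 := by
    have h1 := hp.comp_sub (-a)
    rw [add_neg_cancel] at h1
    have h2 := (HasFPowerSeriesOnBall.compContinuousLinearMap
      (u := ContinuousLinearMap.toSpanSingleton ℂ z) (x := 0) (by simpa using h1)).hasFPowerSeriesAt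
    convert h2 using 1
    funext t
    simp [hg, add_comm]
  -- The series `p` is only known to converge within `ε`; uniqueness of one-variable expansions
  -- identifies its terms along the line with Cauchy coefficients on the large disc.
  have heq := hs1.hasFPowerSeriesAt.eq_formalMultilinearSeries hs2
  have hpk : ∀ k, p k (fun _ => z) = cauchyPowerSeries g 0 ρ k (fun _ => 1) := by
    intro k
    rw [heq]
    rw [FormalMultilinearSeries.compContinuousLinearMap_apply]
    congr 1
    funext _
    simp
  have hgM : ∀ θ : ℝ, ‖g (circleMap 0 ρ θ)‖ ≤ M := fun θ =>
    hM _ (hmem _ (circleMap_mem_closedBall 0 ρ.2 θ))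
  have hM0 : 0 ≤ M := (norm_nonneg _).trans (hgM 0)
  constructor
  · intro k
    rw [hpk]
    refine (ContinuousMultilinearMap.le_opNorm _ _).trans ?_
    simp only [norm_one, Finset.prod_const_one, mul_one]
    refine (norm_cauchyPowerSeries_le g 0 ρ k).trans ?_
    have hint : ∫ θ in (0 : ℝ)..2 * Real.pi, ‖g (circleMap 0 ρ θ)‖ ≤ M * |2 * Real.pi - 0| := by
      refine (Real.le_norm_self _).trans (intervalIntegral.norm_integral_le_of_norm_le_const
        (C := M) (fun θ _ => ?_))
      rw [norm_norm]
      exact hgM θ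
    rw [sub_zero, abs_of_pos Real.two_pi_pos] at hint
    have h1 : (2 * Real.pi)⁻¹ * ∫ θ in (0 : ℝ)..2 * Real.pi, ‖g (circleMap 0 ρ θ)‖ ≤ M := by
      rw [inv_mul_le_iff₀ Real.two_pi_pos]
      linarith
    have h2 : |(ρ : ℝ)|⁻¹ ^ k ≤ 1 := by
      apply pow_le_one₀ (by positivity)
      apply inv_le_one_of_one_le₀
      exact le_abs.2 (Or.inl (by exact_mod_cast hρ1.le))
    calc _ ≤ M * 1 := mul_le_mul h1 h2 (by positivity) hM0
      _ = M := mul_one M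
  · have h1 : (1 : ℂ) ∈ Metric.eball (0 : ℂ) ρ := by
      simpa [Metric.mem_eball] using hρ1
    have h2 := hs1.hasSum h1
    simp_rw [hpk]
    simpa [hg] using h2

/-- The coefficients of the multi-index expansion of a formal multilinear series on `ℂⁿ`. -/
noncomputable def multiCoeff {n : ℕ} (p : FormalMultilinearSeries ℂ (Fin n → ℂ) ℂ)
    (α : Fin n → ℕ) : ℂ :=
  ∑ w : Fin (∑ i, α i) → Fin n with (fun i => (Finset.univ.filter fun j => w j = i).card) = α,
    p (∑ i, α i) (fun j => Pi.single (w j) 1)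

/-- Multilinear expansion in the standard basis gives one term per word of length `k`; words with
equal letter counts contribute the same monomial. -/
lemma sum_multiCoeff {n : ℕ} (p : FormalMultilinearSeries ℂ (Fin n → ℂ) ℂ) (k : ℕ)
    (z : Fin n → ℂ) :
    ∑ α ∈ Finset.piAntidiag Finset.univ k, multiCoeff p α * monom z α = p k (fun _ => z) := by
  classical
  set cnt : (Fin k → Fin n) → (Fin n → ℕ) :=
    fun w i => (Finset.univ.filter fun j => w j = i).card with hcnt
  have hz : z = ∑ i, z i • (Pi.single i 1 : Fin n → ℂ) := by
    funext j
    simp [Finset.sum_apply, Pi.single_apply]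
  have hexp : p k (fun _ => z) =
      ∑ w : Fin k → Fin n, p k (fun j => Pi.single (w j) 1) * monom z (cnt w) := by
    conv_lhs => rw [hz]
    rw [(p k).map_sum (fun _ i => z i • (Pi.single i 1 : Fin n → ℂ))]
    refine Finset.sum_congr rfl fun w _ => ?_
    rw [ContinuousMultilinearMap.map_smul_univ, smul_eq_mul, mul_comm, monom]
    congr 1
    rw [← Finset.prod_fiberwise_of_maps_to (s := Finset.univ) (t := Finset.univ) (g := w)
      (fun _ _ => Finset.mem_univ _)]
    refine Finset.prod_congr rfl fun i _ => ?_
    rw [Finset.prod_congr rfl (g := fun _ => z i), Finset.prod_const]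
    intro j hj
    rw [(Finset.mem_filter.1 hj).2]
  rw [hexp, ← Finset.sum_fiberwise_of_maps_to (s := Finset.univ)
    (t := Finset.piAntidiag Finset.univ k) (g := cnt)]
  · refine Finset.sum_congr rfl fun α hα => ?_
    have hk : ∑ i, α i = k := (Finset.mem_piAntidiag.1 hα).1
    subst hk
    rw [multiCoeff, Finset.sum_mul]
    refine Finset.sum_congr rfl fun w hw => ?_
    rw [(Finset.mem_filter.1 hw).2]
  · intro w _
    rw [Finset.mem_piAntidiag]
    refine ⟨?_, fun _ _ => Finset.mem_univ _⟩
    have := Finset.card_eq_sum_card_fiberwise (f := w) (s := Finset.univ) (t := Finset.univ)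
      (fun _ _ => Finset.mem_univ _)
    simpa [hcnt] using this.symm

/-- A bounded analytic function on a ball of `ℂⁿ` (a polydisc) has a multi-index power series which
satisfies Cauchy's estimates and represents it wherever it is absolutely summable in the ball. -/
lemma exists_multi_powerSeries {n : ℕ} {f : (Fin n → ℂ) → ℂ} {a : Fin n → ℂ} {R M r : ℝ}
    (hr : 0 < r) (hrR : r < R)
    (hf : AnalyticOnNhd ℂ f (Metric.ball a R)) (hM : ∀ x ∈ Metric.ball a R, ‖f x‖ ≤ M) :
    ∃ c : (Fin n → ℕ) → ℂ, (∀ α, ‖c α‖ * r ^ (∑ i, α i) ≤ M) ∧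
      ∀ z, ‖z‖ < R → Summable (fun α => c α * monom z α) →
        ∑' α, c α * monom z α = f (a + z) := by
  classical
  obtain ⟨p, ε, hp⟩ := hf a (Metric.mem_ball_self (hr.trans hrR))
  refine ⟨multiCoeff p, fun α => ?_, fun z hz hsum => ?_⟩
  · refine norm_coeff_mul_pow_le (Finset.piAntidiag Finset.univ (∑ i, α i)) (multiCoeff p) hr.le
      (fun z hz => ?_) (by simp)
    rw [sum_multiCoeff]
    refine (taylor_on_line hf hM hp ?_).1 _
    refine lt_of_le_of_lt ?_ hrR
    exact (pi_norm_le_iff_of_nonneg hr.le).2 fun i => (hz i).le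
  · have h1 := hsum.hasSum.tsum_fiberwise (fun α : Fin n → ℕ => ∑ i, α i)
    have h2 := (taylor_on_line hf hM hp hz).2
    have h3 : (fun k => p k fun _ => z) = fun k =>
        ∑' α : ((fun α : Fin n → ℕ => ∑ i, α i) ⁻¹' {k}), multiCoeff p α * monom z α := by
      funext k
      have hk : (fun α : Fin n → ℕ => ∑ i, α i) ⁻¹' {k} =
          ↑(Finset.piAntidiag (Finset.univ : Finset (Fin n)) k) := by
        ext α
        simp
      rw [← sum_multiCoeff, ← Finset.tsum_subtype, hk]
      rfl
    rw [h3] at h2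
    exact h1.unique h2

/-! ### Neumann series in weighted `ℓ¹` -/

/-- Summation against a double family with finite weighted norm may be interchanged. -/
lemma tsum_mul_comm_of_weighted {κ ι : Type*} {w : ι → ℝ≥0∞} {a : κ → ι → ℂ}
    (ha : ∑' k, ∑' i, ‖a k i‖ₑ * w i ≠ ∞) {χ : ι → ℂ} (hχ : ∀ i, ‖χ i‖ₑ ≤ w i) :
    Summable (fun k => ∑' i, a k i * χ i) ∧
      ∑' i, (∑' k, a k i) * χ i = ∑' k, ∑' i, a k i * χ i := by
  have hs : Summable (Function.uncurry fun k i => a k i * χ i) := by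
    apply Summable.of_enorm
    rw [ENNReal.tsum_prod']
    refine ne_top_of_le_ne_top ha (ENNReal.tsum_le_tsum fun k => ENNReal.tsum_le_tsum fun i => ?_)
    simp only [Function.uncurry_apply_pair, enorm_mul]
    gcongr
    exact hχ i
  refine ⟨hs.prod, ?_⟩
  simp_rw [← tsum_mul_right]
  exact hs.tsum_comm

/-- Solving `u = f + D u` in a weighted `ℓ¹` space, where `D` maps the basis vector `γ` to `d γ`
and has norm at most `1 / 2`. The equation is tested against functionals of weighted norm at
most one. -/
lemma exists_neumann_solution {ι : Type*} (w : ι → ℝ≥0∞) (d : ι → ι → ℂ)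
    (hd : ∀ γ, ∑' β, ‖d γ β‖ₑ * w β ≤ 2⁻¹ * w γ) (f : ι → ℂ)
    (hf : ∑' β, ‖f β‖ₑ * w β ≠ ∞) :
    ∃ u : ι → ℂ, ∑' β, ‖u β‖ₑ * w β ≠ ∞ ∧ ∀ χ : ι → ℂ, (∀ β, ‖χ β‖ₑ ≤ w β) →
      ∑' β, u β * χ β = ∑' β, f β * χ β + ∑' γ, u γ * ∑' β, d γ β * χ β := by
  -- `a k` is `D ^ k f`, and the solution is `u = ∑ D ^ k f`.
  set a : ℕ → ι → ℂ := fun k => (fun (b : ι → ℂ) β => ∑' γ, b γ * d γ β)^[k] f with ha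
  have ha0 : a 0 = f := rfl
  have hasucc : ∀ k β, a (k + 1) β = ∑' γ, a k γ * d γ β := by
    intro k β
    simp only [ha, Function.iterate_succ_apply']
  have hstep : ∀ b : ι → ℂ, ∑' γ, ∑' β, ‖b γ * d γ β‖ₑ * w β ≤ 2⁻¹ * ∑' γ, ‖b γ‖ₑ * w γ := by
    intro b
    rw [← ENNReal.tsum_mul_left]
    refine ENNReal.tsum_le_tsum fun γ => ?_
    simp_rw [enorm_mul, mul_assoc, ENNReal.tsum_mul_left]
    rw [mul_left_comm]
    gcongr
    exact hd γ
  have hN : ∀ k, ∑' β, ‖a k β‖ₑ * w β ≤ 2⁻¹ ^ k * ∑' β, ‖f β‖ₑ * w β := by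
    intro k
    induction k with
    | zero => simp [ha0]
    | succ k ih =>
      calc ∑' β, ‖a (k + 1) β‖ₑ * w β
          ≤ ∑' β, ∑' γ, ‖a k γ * d γ β‖ₑ * w β := by
            refine ENNReal.tsum_le_tsum fun β => ?_
            rw [hasucc, ENNReal.tsum_mul_right]
            gcongr
            exact enorm_tsum_le_tsum_enorm
        _ ≤ 2⁻¹ * ∑' γ, ‖a k γ‖ₑ * w γ := by
            rw [ENNReal.tsum_comm]
            exact hstep _
        _ ≤ _ := by
            rw [pow_succ', mul_assoc]
            gcongr
  have hfin : ∑' k, ∑' β, ‖a k β‖ₑ * w β ≠ ∞ := by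
    refine ne_top_of_le_ne_top ?_ (ENNReal.tsum_le_tsum hN)
    rw [ENNReal.tsum_mul_right, ENNReal.tsum_geometric]
    refine ENNReal.mul_ne_top ?_ hf
    simp
  refine ⟨fun β => ∑' k, a k β, ?_, fun χ hχ => ?_⟩
  · refine ne_top_of_le_ne_top hfin ?_
    rw [ENNReal.tsum_comm]
    refine ENNReal.tsum_le_tsum fun β => ?_
    rw [ENNReal.tsum_mul_right]
    gcongr
    exact enorm_tsum_le_tsum_enorm
  · have hχ' : ∀ γ, ‖∑' β, d γ β * χ β‖ₑ ≤ w γ := by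
      intro γ
      refine enorm_tsum_le_tsum_enorm.trans ?_
      calc ∑' β, ‖d γ β * χ β‖ₑ ≤ ∑' β, ‖d γ β‖ₑ * w β := by
            refine ENNReal.tsum_le_tsum fun β => ?_
            rw [enorm_mul]
            gcongr
            exact hχ β
        _ ≤ 2⁻¹ * w γ := hd γ
        _ ≤ 1 * w γ := by gcongr; simp
        _ = w γ := one_mul _
    obtain ⟨hs, heq⟩ := tsum_mul_comm_of_weighted hfin hχ
    rw [heq, (tsum_mul_comm_of_weighted hfin hχ').2, hs.tsum_eq_zero_add, ha0]
    congr 1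
    refine tsum_congr fun k => ?_
    have hk : ∑' γ, ∑' β, ‖a k γ * d γ β‖ₑ * w β ≠ ∞ := by
      refine ne_top_of_le_ne_top ?_ (hstep (a k))
      exact ENNReal.mul_ne_top (by simp) (ne_top_of_le_ne_top hfin (ENNReal.le_tsum k))
    simp_rw [hasucc]
    rw [(tsum_mul_comm_of_weighted hk hχ).2]
    simp_rw [← tsum_mul_left, mul_assoc]

/-! ### A monomial order and adapted polydiscs -/

/-- An injective numbering of the multi-indices by `α ↦ ∏ i, p i ^ α i` with `p i` the `i`-th prime.
It is a monomial order. -/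
noncomputable def primeCode {n : ℕ} (α : Fin n → ℕ) : ℕ := ∏ i : Fin n, Nat.nth Nat.Prime i ^ α i

lemma primeCode_pos {n : ℕ} (α : Fin n → ℕ) : 0 < primeCode α :=
  Finset.prod_pos fun i _ => pow_pos (Nat.prime_nth_prime i).pos _

lemma primeCode_add {n : ℕ} (α β : Fin n → ℕ) :
    primeCode (α + β) = primeCode α * primeCode β := by
  simp [primeCode, pow_add, Finset.prod_mul_distrib]

lemma primeCode_injective {n : ℕ} : Function.Injective (primeCode (n := n)) := by
  have key : ∀ (α : Fin n → ℕ) (i : Fin n),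
      (primeCode α).factorization (Nat.nth Nat.Prime i) = α i := by
    intro α i
    rw [primeCode, Nat.factorization_prod fun (j : Fin n) _ =>
      pow_ne_zero _ (Nat.prime_nth_prime j).ne_zero]
    simp_rw [(Nat.prime_nth_prime _).factorization_pow]
    rw [Finsupp.finsetSum_apply, Finset.sum_eq_single i]
    · simp
    · intro j _ hj
      rw [Finsupp.single_eq_of_ne]
      intro h
      exact hj (Fin.ext (Nat.nth_injective Nat.infinite_setOfPred_prime h).symm)
    · simp
  intro α β h
  funext i
  rw [← key α i, ← key β i, h]

/-- The weight of the monomial `z ^ α` on the polydisc with radii `(p i)⁻¹ ^ s`. -/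
noncomputable def monomWeight {n : ℕ} (s : ℕ) (α : Fin n → ℕ) : ℝ≥0∞ :=
  ((primeCode α : ℝ≥0∞)⁻¹) ^ s

/-- The closed polydisc around the origin with radii `(p i)⁻¹ ^ s`, `p i` being the `i`-th
prime. -/
def primePolydisc (n s : ℕ) : Set (Fin n → ℂ) :=
  {z | ∀ i, ‖z i‖ₑ ≤ ((Nat.nth Nat.Prime i : ℝ≥0∞)⁻¹) ^ s}

lemma inv_natCast_le_one {m : ℕ} (hm : 0 < m) : (m : ℝ≥0∞)⁻¹ ≤ 1 := by
  rw [ENNReal.inv_le_one]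
  exact_mod_cast hm

lemma monomWeight_antitone {n s t : ℕ} (h : s ≤ t) (α : Fin n → ℕ) :
    monomWeight t α ≤ monomWeight s α :=
  pow_le_pow_right_of_le_one' (inv_natCast_le_one (primeCode_pos α)) h

lemma primePolydisc_antitone {n s t : ℕ} (h : s ≤ t) : primePolydisc n t ⊆ primePolydisc n s :=
  fun _ hz i => (hz i).trans
    (pow_le_pow_right_of_le_one' (inv_natCast_le_one (Nat.prime_nth_prime i).pos) h)

lemma monomWeight_add {n s : ℕ} (α β : Fin n → ℕ) :
    monomWeight s (α + β) = monomWeight s α * monomWeight s β := by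
  rw [monomWeight, primeCode_add, Nat.cast_mul, ENNReal.mul_inv (by simp) (by simp), mul_pow]
  rfl

lemma monomWeight_eq_prod {n s : ℕ} (α : Fin n → ℕ) :
    monomWeight s α = ∏ i : Fin n, (((Nat.nth Nat.Prime i : ℝ≥0∞)⁻¹) ^ s) ^ α i := by
  rw [monomWeight, primeCode, Nat.cast_prod, ENNReal.prod_inv_distrib]
  · rw [← Finset.prod_pow]
    refine Finset.prod_congr rfl fun i _ => ?_
    rw [Nat.cast_pow, ENNReal.inv_pow, ← pow_mul, ← pow_mul, mul_comm]
  · intro i _ j _ _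
    left
    exact_mod_cast (pow_pos (Nat.prime_nth_prime i).pos _).ne'

lemma enorm_monom_le {n s : ℕ} {z : Fin n → ℂ} (hz : z ∈ primePolydisc n s) (α : Fin n → ℕ) :
    ‖monom z α‖ₑ ≤ monomWeight s α := by
  rw [monomWeight_eq_prod, monom]
  have hprod : ∀ g : Fin n → ℂ, ‖∏ i, g i‖ₑ = ∏ i, ‖g i‖ₑ := fun g => by
    simp_rw [enorm_eq_nnnorm, nnnorm_prod, ENNReal.ofNNReal_finsetProd]
  rw [hprod]
  refine Finset.prod_le_prod' fun i _ => ?_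
  rw [enorm_pow]
  exact pow_le_pow_left' (hz i) _

lemma monom_add {n : ℕ} (z : Fin n → ℂ) (α β : Fin n → ℕ) :
    monom z (α + β) = monom z α * monom z β := by
  simp [monom, pow_add, Finset.prod_mul_distrib]

/-- Injectivity of `primeCode` makes this a subsum of `∑ 1 / m ^ 2`. -/
lemma tsum_monomWeight_two_ne_top {n : ℕ} : ∑' α : Fin n → ℕ, monomWeight 2 α ≠ ∞ := by
  have h := ((Real.summable_nat_pow_inv.2 one_lt_two).comp_injective
    (primeCode_injective (n := n))).tsum_ofReal_ne_top
  convert h using 3 with α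
  have h0 : (0 : ℝ) < primeCode α := by exact_mod_cast primeCode_pos α
  rw [monomWeight, Function.comp_apply, ENNReal.ofReal_inv_of_pos (by positivity),
    ENNReal.ofReal_pow h0.le, ENNReal.ofReal_natCast, ENNReal.inv_pow]

/-- Weighted absolute convergence of a multi-index power series. -/
def WeightedSummable {n : ℕ} (s : ℕ) (c : (Fin n → ℕ) → ℂ) : Prop :=
  ∑' α, ‖c α‖ₑ * monomWeight s α ≠ ∞

lemma WeightedSummable.of_le {n s t : ℕ} {c d : (Fin n → ℕ) → ℂ} (hc : WeightedSummable s c)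
    (hst : s ≤ t) (h : ∀ α, ‖d α‖ₑ ≤ ‖c α‖ₑ) : WeightedSummable t d :=
  ne_top_of_le_ne_top hc <| ENNReal.tsum_le_tsum fun α =>
    mul_le_mul' (h α) (monomWeight_antitone hst α)

lemma WeightedSummable.summable {n s : ℕ} {c : (Fin n → ℕ) → ℂ} (hc : WeightedSummable s c)
    {z : Fin n → ℂ} (hz : z ∈ primePolydisc n s) : Summable fun α => c α * monom z α := by
  apply Summable.of_enorm
  refine ne_top_of_le_ne_top hc (ENNReal.tsum_le_tsum fun α => ?_)
  rw [enorm_mul]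
  gcongr
  exact enorm_monom_le hz α

/-- On small polydiscs a monomial dominates every convergent series of larger monomials. -/
lemma exists_tsum_le_half_monomWeight {n s₀ : ℕ} {e : (Fin n → ℕ) → ℂ} (he : WeightedSummable s₀ e)
    {α : Fin n → ℕ} (hα : ∀ β, e β ≠ 0 → primeCode α < primeCode β) :
    ∃ t, ∀ s ≥ t, ∑' β, ‖e β‖ₑ * monomWeight s β ≤ 2⁻¹ * monomWeight s α := by
  set A : ℝ≥0∞ := (primeCode α : ℝ≥0∞) with hA
  have hA0 : A ≠ 0 := Nat.cast_ne_zero.2 (primeCode_pos α).ne'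
  have hAt : A ≠ ∞ := ENNReal.natCast_ne_top _
  -- Codes are integers, so every exponent in the tail has code at least `A + 1`. Raising `s` by one
  -- multiplies the tail by at most `(A + 1)⁻¹` and the leading weight by `A⁻¹`; their ratio gains
  -- the factor `q < 1`.
  set q : ℝ≥0∞ := A * (A + 1)⁻¹ with hq
  have hq1 : q < 1 := by
    rw [hq, ← div_eq_mul_inv]
    refine (ENNReal.div_lt_iff (by simp) (by simp [hAt])).2 ?_
    rw [one_mul]
    exact ENNReal.lt_add_right hAt one_ne_zero
  have hqA : q * A⁻¹ = (A + 1)⁻¹ := by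
    rw [hq, mul_right_comm, ENNReal.mul_inv_cancel hA0 hAt, one_mul]
  have hlim : Filter.Tendsto (fun k => q ^ k * ∑' β, ‖e β‖ₑ * monomWeight s₀ β) Filter.atTop
      (nhds 0) := by
    have := ENNReal.Tendsto.mul_const (ENNReal.tendsto_pow_atTop_nhds_zero_of_lt_one hq1)
      (Or.inr he)
    rwa [zero_mul] at this
  have hpos : 0 < 2⁻¹ * A⁻¹ ^ s₀ :=
    ENNReal.mul_pos (by simp) (pow_ne_zero _ (by simpa using hAt))
  obtain ⟨k₀, hk₀⟩ := Filter.eventually_atTop.1 (hlim.eventually (gt_mem_nhds hpos))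
  refine ⟨s₀ + k₀, fun s hs => ?_⟩
  obtain ⟨k, rfl⟩ : ∃ k, s = s₀ + k := ⟨s - s₀, by omega⟩
  have hterm : ∀ β, ‖e β‖ₑ * monomWeight (s₀ + k) β ≤
      (‖e β‖ₑ * monomWeight s₀ β) * (A + 1)⁻¹ ^ k := by
    intro β
    by_cases hβ : e β = 0
    · simp [hβ]
    · rw [monomWeight, pow_add, mul_assoc]
      unfold monomWeight
      gcongr
      rw [hA]
      exact_mod_cast hα β hβ
  calc ∑' β, ‖e β‖ₑ * monomWeight (s₀ + k) β
      ≤ ∑' β, (‖e β‖ₑ * monomWeight s₀ β) * (A + 1)⁻¹ ^ k := ENNReal.tsum_le_tsum hterm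
    _ = (q ^ k * ∑' β, ‖e β‖ₑ * monomWeight s₀ β) * A⁻¹ ^ k := by
      rw [ENNReal.tsum_mul_right, ← hqA, mul_pow]
      ring
    _ ≤ (2⁻¹ * A⁻¹ ^ s₀) * A⁻¹ ^ k := by
      exact mul_le_mul_left (hk₀ k (by omega)).le _
    _ = 2⁻¹ * monomWeight (s₀ + k) α := by
      rw [monomWeight, pow_add, mul_assoc]

/-! ### Leading exponents and division -/

/-- The series `c` converges near the origin and, near the origin, vanishes on the common zeros of
finitely many members of `I`. -/
def VanishesOnGerm {n : ℕ} (I : Set ((Fin n → ℂ) → ℂ)) (c : (Fin n → ℕ) → ℂ) : Prop :=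
  ∃ F ⊆ I, F.Finite ∧ ∃ s, WeightedSummable s c ∧
    ∀ z ∈ primePolydisc n s, (∀ f ∈ F, f z = 0) → ∑' α, c α * monom z α = 0

/-- `α` is the leading exponent of `c`. -/
def IsLeadingExponent {n : ℕ} (c : (Fin n → ℕ) → ℂ) (α : Fin n → ℕ) : Prop :=
  c α ≠ 0 ∧ ∀ β, β ≠ α → c β ≠ 0 → primeCode α < primeCode β

lemma exists_isLeadingExponent {n : ℕ} {c : (Fin n → ℕ) → ℂ} (hc : c ≠ 0) :
    ∃ α, IsLeadingExponent c α := by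
  obtain ⟨β, hβ⟩ := Function.ne_iff.1 hc
  obtain ⟨α, hα, hmin⟩ := (InvImage.wf (primeCode (n := n)) wellFounded_lt).has_min
    {α | c α ≠ 0} ⟨β, hβ⟩
  exact ⟨α, hα, fun γ hγα hγ => lt_of_le_of_ne (not_lt.1 (hmin γ hγ))
    fun h => hγα (primeCode_injective h).symm⟩

/-- Near the common zeros, a leading monomial is equal to the negative of the normalized tail, and
the tail is small. -/
lemma VanishesOnGerm.exists_tail {n : ℕ} {I : Set ((Fin n → ℂ) → ℂ)} {c : (Fin n → ℕ) → ℂ}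
    (hc : VanishesOnGerm I c) {α : Fin n → ℕ} (hα : IsLeadingExponent c α) :
    ∃ (e : (Fin n → ℕ) → ℂ) (F : Set ((Fin n → ℂ) → ℂ)) (t : ℕ), F ⊆ I ∧ F.Finite ∧ ∀ s ≥ t,
      ∑' β, ‖e β‖ₑ * monomWeight s β ≤ 2⁻¹ * monomWeight s α ∧
      ∀ z ∈ primePolydisc n s, (∀ f ∈ F, f z = 0) → ∑' β, e β * monom z β = monom z α := by
  classical
  obtain ⟨F, hFI, hF, s₀, hs, hz⟩ := hc
  set e : (Fin n → ℕ) → ℂ := fun β => if β = α then 0 else -(c α)⁻¹ * c β with he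
  have heS : WeightedSummable s₀ e := by
    have h1 : ∑' β, ‖e β‖ₑ * monomWeight s₀ β ≤
        ‖(c α)⁻¹‖ₑ * ∑' β, ‖c β‖ₑ * monomWeight s₀ β := by
      rw [← ENNReal.tsum_mul_left]
      refine ENNReal.tsum_le_tsum fun β => ?_
      rw [← mul_assoc]
      gcongr
      simp only [he]
      split_ifs
      · simp
      · rw [enorm_mul, enorm_neg]
    exact ne_top_of_le_ne_top (ENNReal.mul_ne_top (by simp) hs) h1
  obtain ⟨t, ht⟩ := exists_tsum_le_half_monomWeight heS (α := α) (by
    intro β hβ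
    by_cases h : β = α
    · simp [he, h] at hβ
    · refine hα.2 β h fun h0 => hβ ?_
      simp [he, h0])
  refine ⟨e, F, max t s₀, hFI, hF, fun s hst => ⟨ht s (le_trans (le_max_left _ _) hst), ?_⟩⟩
  intro z hzs hzF
  have hzs₀ := primePolydisc_antitone (le_trans (le_max_right _ _) hst) hzs
  have h0 := hz z hzs₀ hzF
  have hsum : (fun β => e β * monom z β) = fun β =>
      (if β = α then monom z α else 0) + -(c α)⁻¹ * (c β * monom z β) := by
    funext β
    simp only [he]
    split_ifs with h
    · subst h
      field_simp [hα.1]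
      simp
    · ring
  rw [hsum, Summable.tsum_add, tsum_ite_eq, tsum_mul_left, h0, mul_zero, add_zero]
  · exact summable_of_hasFiniteSupport ((Set.finite_singleton α).subset fun β hβ => by
      by_contra h
      exact hβ (if_neg h))
  · exact (hs.summable hzs₀).mul_left _

/-- Multiplication of a power series by the monomial `z ^ δ`. -/
noncomputable def shiftCoeff {n : ℕ} (δ : Fin n → ℕ) (e : (Fin n → ℕ) → ℂ) (β : Fin n → ℕ) : ℂ :=
  open Classical in if δ ≤ β then e (β - δ) else 0

/-- The general `φ` covers both uses: weighted norms and values at a point. -/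
lemma tsum_shiftCoeff {n : ℕ} {X : Type*} [AddCommMonoid X] [TopologicalSpace X]
    (φ : (Fin n → ℕ) → ℂ → X) (hφ : ∀ β, φ β 0 = 0) (δ : Fin n → ℕ) (e : (Fin n → ℕ) → ℂ) :
    ∑' β, φ β (shiftCoeff δ e β) = ∑' β, φ (β + δ) (e β) := by
  rw [← Function.Injective.tsum_eq (add_left_injective δ)]
  · refine tsum_congr fun β => ?_
    simp [shiftCoeff]
  · intro β hβ
    by_cases h : δ ≤ β
    · exact ⟨β - δ, tsub_add_cancel_of_le h⟩
    · simp [shiftCoeff, h, hφ] at hβ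

/-- Local finiteness of common zeros: a family of functions given by power series on a common
polydisc has the same zeros, on a smaller polydisc, as a finite subfamily. -/
theorem exists_finite_subfamily_zeros {n : ℕ} (I : Set ((Fin n → ℂ) → ℂ)) (s₀ : ℕ)
    (hI : ∀ f ∈ I, ∃ c, WeightedSummable s₀ c ∧
      ∀ z ∈ primePolydisc n s₀, ∑' α, c α * monom z α = f z) :
    ∃ F ⊆ I, F.Finite ∧ ∃ s, ∀ z ∈ primePolydisc n s, (∀ f ∈ F, f z = 0) → ∀ f ∈ I, f z = 0 := by
  classical
  set E : Set (Fin n → ℕ) := {α | ∃ c, VanishesOnGerm I c ∧ IsLeadingExponent c α} with hE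
  set B : Set (Fin n → ℕ) := {α | Minimal (· ∈ E) α} with hB
  -- Dickson's lemma: an antichain in `ℕ ^ n` is finite.
  have hBfin : B.Finite :=
    (setOfPred_minimal_antichain (· ∈ E)).finite_of_partiallyWellOrderedOn
      (Set.isPWO_of_wellQuasiOrderedLE B)
  have htail : ∀ α, α ∈ E → ∃ (e : (Fin n → ℕ) → ℂ) (F : Set ((Fin n → ℂ) → ℂ)) (t : ℕ),
      F ⊆ I ∧ F.Finite ∧ ∀ s ≥ t,
      ∑' β, ‖e β‖ₑ * monomWeight s β ≤ 2⁻¹ * monomWeight s α ∧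
      ∀ z ∈ primePolydisc n s, (∀ f ∈ F, f z = 0) → ∑' β, e β * monom z β = monom z α := by
    rintro α ⟨c, hc, hα⟩
    exact hc.exists_tail hα
  choose! e F t hFI hF ht using htail
  -- The polydisc is fixed here, before `f` is chosen; the division below does not shrink it.
  obtain ⟨s, hs₀, hst⟩ : ∃ s, s₀ ≤ s ∧ ∀ α ∈ B, t α ≤ s :=
    ⟨max s₀ (hBfin.toFinset.sup t), le_max_left _ _, fun α hα =>
      (Finset.le_sup (hBfin.mem_toFinset.2 hα)).trans (le_max_right _ _)⟩
  have hUI : (⋃ α ∈ B, F α) ⊆ I := Set.iUnion₂_subset fun α hα => hFI α hα.1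
  have hUfin : (⋃ α ∈ B, F α).Finite := hBfin.biUnion fun α hα => hF α hα.1
  refine ⟨⋃ α ∈ B, F α, hUI, hUfin, s, fun z hz hzF f hf => ?_⟩
  obtain ⟨c, hc, hcf⟩ := hI f hf
  set Δ : Set (Fin n → ℕ) := {γ | ∃ α ∈ B, α ≤ γ} with hΔ
  have hm : ∀ γ, γ ∈ Δ → ∃ α, α ∈ B ∧ α ≤ γ := fun γ h => h
  choose! m hmB hmle using hm
  -- One division step: for `γ ∈ Δ`, `z ^ γ` is replaced by `z ^ (γ - m γ)` times the tail for `m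
  -- γ`, which has the same values on the common zeros and at most half the weight.
  set d : (Fin n → ℕ) → (Fin n → ℕ) → ℂ := fun γ β =>
    if γ ∈ Δ then shiftCoeff (γ - m γ) (e (m γ)) β else 0 with hd
  have hdle : ∀ γ, ∑' β, ‖d γ β‖ₑ * monomWeight s β ≤ 2⁻¹ * monomWeight s γ := by
    intro γ
    by_cases hγ : γ ∈ Δ
    · simp only [hd, if_pos hγ]
      rw [tsum_shiftCoeff (fun β x => ‖x‖ₑ * monomWeight s β) (by simp)]
      simp_rw [monomWeight_add, ← mul_assoc]
      rw [ENNReal.tsum_mul_right]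
      calc _ ≤ 2⁻¹ * monomWeight s (m γ) * monomWeight s (γ - m γ) := by
            gcongr
            exact (ht _ (hmB γ hγ).1 s (hst _ (hmB γ hγ))).1
        _ = 2⁻¹ * monomWeight s γ := by
            rw [mul_assoc, ← monomWeight_add, add_tsub_cancel_of_le (hmle γ hγ)]
    · simp [hd, hγ]
  have hcs : WeightedSummable s c := hc.of_le hs₀ fun _ => le_rfl
  obtain ⟨u, hu, hueq⟩ := exists_neumann_solution (monomWeight s) d hdle c hcs
  set h : (Fin n → ℕ) → ℂ := fun γ => if γ ∈ Δ then 0 else u γ with hh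
  have hhS : WeightedSummable s h := WeightedSummable.of_le hu le_rfl fun γ => by
    simp only [hh]
    split_ifs <;> simp
  -- On the common zeros `D` preserves the value of each monomial in `Δ` and kills the others. There
  -- `u = c + D u` says that the part of `u` off `Δ` has the value of `f`.
  have hval : ∀ z ∈ primePolydisc n s, (∀ f ∈ ⋃ α ∈ B, F α, f z = 0) →
      ∑' α, h α * monom z α = f z := by
    intro z hz hzF
    have h1 := hueq (monom z) (enorm_monom_le hz)
    rw [hcf z (primePolydisc_antitone hs₀ hz)] at h1
    have h2 : ∀ γ, u γ * ∑' β, d γ β * monom z β = u γ * monom z γ - h γ * monom z γ := by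
      intro γ
      by_cases hγ : γ ∈ Δ
      · simp only [hd, hh, if_pos hγ, zero_mul, sub_zero]
        rw [tsum_shiftCoeff (fun β x => x * monom z β) (by simp)]
        simp_rw [monom_add, ← mul_assoc]
        rw [tsum_mul_right, (ht _ (hmB γ hγ).1 s (hst _ (hmB γ hγ))).2 z hz
          (fun f hf => hzF f (Set.mem_biUnion (hmB γ hγ) hf)), ← monom_add,
          add_tsub_cancel_of_le (hmle γ hγ)]
      · simp [hd, hh, hγ]
    simp_rw [h2] at h1
    rw [(WeightedSummable.summable hu hz).tsum_sub (hhS.summable hz)] at h1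
    linear_combination h1
  have hh0 : h = 0 := by
    by_contra hne
    obtain ⟨α, hα⟩ := exists_isLeadingExponent hne
    -- Adding `f` to the finite subfamily makes `h` vanish on its zeros, so `α ∈ E` and thus `α ∈
    -- Δ`, where `h` has no coefficients.
    have hαE : α ∈ E := by
      refine ⟨h, ⟨insert f (⋃ α ∈ B, F α), Set.insert_subset hf hUI, hUfin.insert f, s, hhS,
        fun z hz hzF => ?_⟩, hα⟩
      rw [hval z hz fun g hg => hzF g (Set.mem_insert_of_mem _ hg)]
      exact hzF f (Set.mem_insert _ _)
    obtain ⟨β, hβα, hβ⟩ := exists_minimal_le_of_wellFoundedLT (· ∈ E) α hαE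
    exact hα.1 (if_pos ⟨β, hβ, hβα⟩)
  rw [← hval z hz hzF, hh0]
  simp

/-! ### From power series to holomorphic functions on `Ω` -/

lemma primePolydisc_mem_nhds (n s : ℕ) : primePolydisc n s ∈ nhds (0 : Fin n → ℂ) := by
  refine Filter.eventually_all.2 fun i => ?_
  have hcont : ContinuousAt (fun z : Fin n → ℂ => ‖z i‖ₑ) 0 :=
    (continuous_apply i).enorm.continuousAt
  refine (hcont.eventually (gt_mem_nhds ?_)).mono fun _ h => h.le
  simp only [Pi.zero_apply, enorm_zero]
  exact pos_iff_ne_zero.2 (pow_ne_zero s (by simp))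

/-- Bounded analytic functions on a ball have power series that converge on a common polydisc. -/
lemma exists_common_powerSeries {n : ℕ} {R : ℝ} (hR : 0 < R) (a : Fin n → ℂ) :
    ∃ s, ∀ (f : (Fin n → ℂ) → ℂ) (M : ℝ), AnalyticOnNhd ℂ f (Metric.ball a R) →
      (∀ x ∈ Metric.ball a R, ‖f x‖ ≤ M) → ∃ c, WeightedSummable s c ∧
        ∀ z ∈ primePolydisc n s, ∑' α, c α * monom z α = f (a + z) := by
  obtain ⟨k, hk⟩ : ∃ k : ℕ, (2⁻¹ : ℝ≥0∞) ^ k < ENNReal.ofReal (R / 2) :=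
    ((ENNReal.tendsto_pow_atTop_nhds_zero_of_lt_one (by simp)).eventually
      (gt_mem_nhds (by simpa using hR))).exists
  have hrad : ∀ i : ℕ, ((Nat.nth Nat.Prime i : ℝ≥0∞)⁻¹) ^ k ≤ ENNReal.ofReal (R / 2) := by
    intro i
    refine le_trans ?_ hk.le
    gcongr
    exact_mod_cast (Nat.prime_nth_prime i).two_le
  -- The power `k` puts the polydisc within radius `R / 2`, since all primes are at least `2`; the
  -- extra `2` makes the Cauchy bounds summable, whatever `M` is.
  refine ⟨k + 2, fun f M hf hM => ?_⟩
  obtain ⟨c, hc, hcf⟩ := exists_multi_powerSeries (half_pos hR) (half_lt_self hR) hf hM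
  have hcS : WeightedSummable (k + 2) c := by
    have h1 : ∀ α, ‖c α‖ₑ * monomWeight (k + 2) α ≤ ENNReal.ofReal M * monomWeight 2 α := by
      intro α
      rw [monomWeight, pow_add, ← mul_assoc]
      change ‖c α‖ₑ * monomWeight k α * monomWeight 2 α ≤ _
      gcongr
      calc ‖c α‖ₑ * monomWeight k α
          ≤ ‖c α‖ₑ * ∏ i, ENNReal.ofReal (R / 2) ^ α i := by
            rw [monomWeight_eq_prod]
            exact mul_le_mul_right (Finset.prod_le_prod' fun (i : Fin n) _ =>
              pow_le_pow_left' (hrad i) _) _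
        _ = ENNReal.ofReal (‖c α‖ * (R / 2) ^ ∑ i, α i) := by
            rw [Finset.prod_pow_eq_pow_sum, ENNReal.ofReal_mul (norm_nonneg _), ofReal_norm,
              ENNReal.ofReal_pow (half_pos hR).le]
        _ ≤ ENNReal.ofReal M := ENNReal.ofReal_le_ofReal (hc α)
    refine ne_top_of_le_ne_top ?_ (ENNReal.tsum_le_tsum h1)
    rw [ENNReal.tsum_mul_left]
    exact ENNReal.mul_ne_top ENNReal.ofReal_ne_top tsum_monomWeight_two_ne_top
  refine ⟨c, hcS, fun z hz => hcf z ?_ (hcS.summable hz)⟩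
  refine lt_of_le_of_lt ((pi_norm_le_iff_of_nonneg (half_pos hR).le).2 fun i => ?_)
    (half_lt_self hR)
  have h1 := (primePolydisc_antitone (Nat.le_add_right k 2) hz i).trans (hrad i)
  rwa [← ofReal_norm, ENNReal.ofReal_le_ofReal_iff (half_pos hR).le] at h1

/-- Bounded analytic functions on an open set locally have the same common zeros as finitely many
of them. -/
theorem exists_finite_local_zeros {n : ℕ} {Ω : Set (Fin n → ℂ)} (hΩ : IsOpen Ω)
    (I : Set ((Fin n → ℂ) → ℂ)) (hI : ∀ f ∈ I, AnalyticOnNhd ℂ f Ω)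
    (hIM : ∀ f ∈ I, ∃ M : ℝ, ∀ z ∈ Ω, ‖f z‖ ≤ M) {a : Fin n → ℂ} (ha : a ∈ Ω) :
    ∃ W, IsOpen W ∧ a ∈ W ∧ W ⊆ Ω ∧ ∃ F ⊆ I, F.Finite ∧
      ∀ z ∈ W, (∀ f ∈ F, f z = 0) → ∀ f ∈ I, f z = 0 := by
  obtain ⟨R, hR, hball⟩ := Metric.isOpen_iff.1 hΩ a ha
  obtain ⟨s₀, hs₀⟩ := exists_common_powerSeries hR a
  obtain ⟨F, hFI, hFfin, s, hs⟩ := Set.exists_subset_image_finite_and.1 <|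
    exists_finite_subfamily_zeros ((fun f z => f (a + z)) '' I) s₀ (by
      rintro _ ⟨f, hf, rfl⟩
      obtain ⟨M, hM⟩ := hIM f hf
      exact hs₀ f M ((hI f hf).mono hball) fun x hx => hM x (hball hx))
  have hnhds : {z | z - a ∈ primePolydisc n s} ∈ nhds a := by
    have hcont : ContinuousAt (fun z : Fin n → ℂ => z - a) a := by fun_prop
    exact hcont (by simpa using primePolydisc_mem_nhds n s)
  refine ⟨interior {z | z - a ∈ primePolydisc n s} ∩ Ω, isOpen_interior.inter hΩ,
    ⟨mem_interior_iff_mem_nhds.2 hnhds, ha⟩, Set.inter_subset_right, F, hFI, hFfin, ?_⟩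
  rintro z ⟨hz, -⟩ hzF f hf
  have h := hs (z - a) (interior_subset (s := {z | z - a ∈ primePolydisc n s}) hz)
    (by rintro _ ⟨g, hg, rfl⟩; simpa using hzF g hg) _ ⟨f, hf, rfl⟩
  simpa using h

/-! ### Bounded holomorphic functions that vanish on `V` -/

lemma enorm_le_supNormOn {n : ℕ} {S : Set (Fin n → ℂ)} (f : (Fin n → ℂ) → ℂ) {z : Fin n → ℂ}
    (hz : z ∈ S) : ‖f z‖ₑ ≤ supNormOn S f :=
  le_iSup₂ (f := fun w (_ : w ∈ S) => ‖f w‖ₑ) z hz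

lemma isBoundedHolomorphicOn_eval {n : ℕ} {Ω : Set (Fin n → ℂ)} (hb : Bornology.IsBounded Ω)
    (p : MvPolynomial (Fin n) ℂ) :
    IsBoundedHolomorphicOn Ω (fun z => MvPolynomial.eval z p) := by
  constructor
  · exact AnalyticOnNhd.eval_mvPolynomial p |>.mono (Set.subset_univ _)
  · obtain ⟨C, hC⟩ := hb.isCompact_closure.exists_bound_of_continuousOn
      (MvPolynomial.continuous_eval p).continuousOn
    refine lt_of_le_of_lt (iSup₂_le fun z hz => ?_) (ENNReal.ofReal_lt_top (r := C))
    rw [← ofReal_norm]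
    exact ENNReal.ofReal_le_ofReal (hC z (subset_closure hz))

lemma IsBoundedHolomorphicOn.sub {n : ℕ} {Ω : Set (Fin n → ℂ)} {f g : (Fin n → ℂ) → ℂ}
    (hf : IsBoundedHolomorphicOn Ω f) (hg : IsBoundedHolomorphicOn Ω g) :
    IsBoundedHolomorphicOn Ω (f - g) := by
  refine ⟨hf.1.sub hg.1, lt_of_le_of_lt (iSup₂_le fun z hz => ?_)
    (ENNReal.add_lt_top.2 ⟨hf.2, hg.2⟩)⟩
  exact enorm_sub_le.trans (add_le_add (enorm_le_supNormOn f hz) (enorm_le_supNormOn g hz))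

/-- Outside `V`, some bounded holomorphic function that vanishes on `V` is not zero. -/
lemma exists_boundedHolomorphic_ne_zero {n : ℕ} {Ω V : Set (Fin n → ℂ)}
    (hb : Bornology.IsBounded Ω) (hconv : IsRelPolynomiallyConvex Ω V)
    (hext : HasExtensionProperty Ω V) {z : Fin n → ℂ} (hz : z ∈ Ω) (hzV : z ∉ V) :
    ∃ f, IsBoundedHolomorphicOn Ω f ∧ (∀ w ∈ V, f w = 0) ∧ f z ≠ 0 := by
  have hhull : z ∉ polynomialHull V := fun h => hzV (hconv ▸ ⟨h, hz⟩)
  simp only [polynomialHull, Set.mem_ofPred_eq, not_forall, not_le] at hhull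
  obtain ⟨p, hp⟩ := hhull
  obtain ⟨F, hF, hFV, hFnorm⟩ := hext p
  refine ⟨F - fun z => MvPolynomial.eval z p, hF.sub (isBoundedHolomorphicOn_eval hb p),
    fun w hw => by simp [hFV w hw], fun h => ?_⟩
  have h1 : F z = MvPolynomial.eval z p := by simpa [sub_eq_zero] using h
  have h2 := enorm_le_supNormOn F hz
  -- If `F z = p z`, equality of norms would give `|p z| ≤ ‖p‖_V`, against the choice of `p`.
  rw [h1, hFnorm] at h2
  exact absurd hp (not_lt.2 h2)

theorem lemma4p3 (n : ℕ) (Ω V : Set (Fin n → ℂ)) (hΩ : IsOpen Ω) (hb : Bornology.IsBounded Ω)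
    (hVΩ : V ⊆ Ω) (hconv : IsRelPolynomiallyConvex Ω V) (hext : HasExtensionProperty Ω V) :
    IsHolomorphicSubvariety Ω V ∧
    ∀ a ∈ Ω, ∃ W : Set (Fin n → ℂ), IsOpen W ∧ a ∈ W ∧ W ⊆ Ω ∧
      ∃ (k : ℕ) (f : Fin k → (Fin n → ℂ) → ℂ),
        (∀ i, IsBoundedHolomorphicOn Ω (f i)) ∧ V ∩ W = {z | z ∈ W ∧ ∀ i, f i z = 0} := by
  have main : ∀ a ∈ Ω, ∃ W : Set (Fin n → ℂ), IsOpen W ∧ a ∈ W ∧ W ⊆ Ω ∧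
      ∃ (k : ℕ) (f : Fin k → (Fin n → ℂ) → ℂ),
        (∀ i, IsBoundedHolomorphicOn Ω (f i)) ∧ V ∩ W = {z | z ∈ W ∧ ∀ i, f i z = 0} := by
    intro a ha
    obtain ⟨W, hWo, haW, hWΩ, F, hFI, hFfin, hF⟩ := exists_finite_local_zeros hΩ
      {f | IsBoundedHolomorphicOn Ω f ∧ ∀ w ∈ V, f w = 0} (fun f hf => hf.1.1)
      (fun f hf => ⟨(supNormOn Ω f).toReal, fun z hz => by
        rw [← toReal_enorm]
        exact ENNReal.toReal_mono hf.1.2.ne (enorm_le_supNormOn f hz)⟩) ha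
    obtain ⟨k, f, hf⟩ := hFfin.fin_embedding
    refine ⟨W, hWo, haW, hWΩ, k, f, fun i => (hFI (hf ▸ Set.mem_range_self i)).1, ?_⟩
    ext z
    constructor
    · rintro ⟨hzV, hzW⟩
      exact ⟨hzW, fun i => (hFI (hf ▸ Set.mem_range_self i)).2 z hzV⟩
    · rintro ⟨hzW, hz⟩
      refine ⟨by_contra fun hzV => ?_, hzW⟩
      obtain ⟨g, hg, hgV, hgz⟩ :=
        exists_boundedHolomorphic_ne_zero hb hconv hext (hWΩ hzW) hzV
      refine hgz (hF z hzW (fun f' hf' => ?_) g ⟨hg, hgV⟩)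
      obtain ⟨i, rfl⟩ := hf.symm ▸ hf'
      exact hz i
  refine ⟨⟨hVΩ, fun a ha => ?_⟩, main⟩
  obtain ⟨W, hWo, haW, hWΩ, k, f, hf, hVW⟩ := main a ha
  exact ⟨W, hWo, haW, hWΩ, k, f, fun i => (hf i).1.mono hWΩ, hVW⟩
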